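/- Let $n$ and $m\geq 1$ be integers, let $0<\alpha<2$ be real with $2m+\alpha<n$, and let $a\geq 0$ and $0<p<\dfrac{n+2m+\alpha+2a}{n-2m-\alpha}$ be real. Let $$R_{2m+\alpha,n}=\frac{\Gamma\left(\frac{n-2m-\alpha}{2}\right)}{\pi^{n/2}\,2^{2m+\alpha}\,\Gamma\left(\frac{2m+\alpha}{2}\right)}.$$ Suppose that $u:\mathbb{R}^n\to\mathbb{R}$ is continuous and nonnegative and that, for every $x\in\mathbb{R}^n$, the following integral converges and $$u(x)=\int_{\mathbb{R}^n}\frac{R_{2m+\alpha,n}}{|x-y|^{n-2m-\alpha}}\,|y|^{a}\,u(y)^{p}\,dy .$$ Then $u(x)=0$ for every $x\in\mathbb{R}^n$. -/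

import Mathlib

open MeasureTheory

noncomputable section

/-- The constant of the Riesz potential of order `γ` in dimension `n`, for `0 < γ < n`:
`R_{γ,n} = Γ((n - γ) / 2) / (π^{n/2} 2^γ Γ(γ / 2))`. -/
def rieszConst (γ : ℝ) (n : ℕ) : ℝ :=
  Real.Gamma (((n : ℝ) - γ) / 2) /
    (Real.pi ^ ((n : ℝ) / 2) * (2 : ℝ) ^ γ * Real.Gamma (γ / 2))

/-- The Riesz kernel `R_{γ,n} / |x - y|^{n - γ}` on `ℝⁿ` with the Euclidean norm. -/
def rieszKernel (γ : ℝ) (n : ℕ) (x y : EuclideanSpace ℝ (Fin n)) : ℝ :=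
  rieszConst γ n / ‖x - y‖ ^ ((n : ℝ) - γ)

/-- `u` solves `u(x) = ∫ R_{γ,n} / |x - y|^{n - γ} f(y, u(y)) dy` at every point `x` of `ℝⁿ`;
that the integral converges (absolutely) at every `x` is part of being a solution. -/
def IsRieszIntegralSolution (γ : ℝ) (n : ℕ) (f : EuclideanSpace ℝ (Fin n) → ℝ → ℝ)
    (u : EuclideanSpace ℝ (Fin n) → ℝ) : Prop :=
  ∀ x, Integrable (fun y => rieszKernel γ n x y * f y (u y)) volume ∧
    u x = ∫ y, rieszKernel γ n x y * f y (u y)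

/-- The Hardy–Hénon nonlinearity `f(x, s) = |x|^a s^p`. -/
def hardyHenon (n : ℕ) (a p : ℝ) (x : EuclideanSpace ℝ (Fin n)) (s : ℝ) : ℝ :=
  ‖x‖ ^ a * s ^ p

end

/-! The proof is the method of scaling spheres. Put `N = n - 2m - α`, `d = n`, and suppose that `u`
is not identically zero; the integral equation then gives `u ≥ C (‖x‖ + ρ) ^ (-N) > 0`.

A lower bound `C ‖x‖ ^ (-ν)` at infinity, fed back into the equation, becomes one of order `‖x‖ ^ (a
+ d - N - p ν)`. If `(p - 1) ν < a + d - N`, each round gains a fixed amount in the exponent until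
the bounds force `u 0 = ∞` (`IsPotential.false_of_lower_bound`). For `p ≤ 1` the rate `ν = N`
already qualifies. For `p ≥ 1` the rate `ν = N / 2` is enough: the condition is then exactly
subcriticality, `τ = 2d + 2a - N - N p > 0`.

The rate `N / 2` follows once `u` is dominated, inside every sphere centred at the origin, by its
Kelvin transform in that sphere. After rescaling to the unit sphere,
`IsPotential.kelvinTransform_sub` writes the gap as an integral over the ball of a positive kernel
times a difference of sources, and `τ > 0` favours the reflected source. Small radii are dominated
because the rescaled constant is small (`IsPotential.exists_Ioc_subset_dominatedRadii`). Domination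
extends past any radius, since the gap is uniformly positive away from the sphere and the remaining
shell is thin (`IsPotential.eventually_mem_dominatedRadii`). The set of dominated radii is closed,
so it contains all positive ones. -/

open Metric Set Filter Topology Module

/-! ### Inversion in the unit sphere and its change of variables. -/

section Inversion

/-- The unit ball without its center. -/
def puncturedBall (E : Type*) [NormedAddCommGroup E] : Set E := ball 0 1 \ {0}

lemma mem_puncturedBall {E : Type*} [NormedAddCommGroup E] {x : E} :
    x ∈ puncturedBall E ↔ ‖x‖ < 1 ∧ x ≠ 0 := by
  simp [puncturedBall]

lemma measurableSet_puncturedBall {E : Type*} [NormedAddCommGroup E] [MeasurableSpace E]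
    [BorelSpace E] : MeasurableSet (puncturedBall E) :=
  measurableSet_ball.diff (measurableSet_singleton 0)

variable {E : Type*} [NormedAddCommGroup E] [InnerProductSpace ℝ E]

/-- The inversion `x ↦ x / ‖x‖²` in the unit sphere. -/
noncomputable def unitInversion (x : E) : E := EuclideanGeometry.inversion 0 1 x

lemma unitInversion_eq (x : E) : unitInversion x = (‖x‖ ^ 2)⁻¹ • x := by
  simp [unitInversion, EuclideanGeometry.inversion]

lemma unitInversion_unitInversion (x : E) : unitInversion (unitInversion x) = x :=
  EuclideanGeometry.inversion_inversion _ one_ne_zero _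

lemma norm_unitInversion (x : E) : ‖unitInversion x‖ = ‖x‖⁻¹ := by
  have := EuclideanGeometry.dist_inversion_center (0 : E) x 1
  simpa [unitInversion] using this

lemma unitInversion_ne_zero {x : E} (hx : x ≠ 0) : unitInversion x ≠ 0 := by
  rw [← norm_ne_zero_iff, norm_unitInversion]
  exact inv_ne_zero (norm_ne_zero_iff.2 hx)

lemma unitInversion_smul {t : ℝ} (x : E) :
    unitInversion (t • x) = t⁻¹ • unitInversion x := by
  rcases eq_or_ne t 0 with rfl | ht
  · simp [unitInversion_eq]
  rw [unitInversion_eq, unitInversion_eq, norm_smul, smul_smul, smul_smul, mul_pow,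
    Real.norm_eq_abs, sq_abs]
  congr 1
  rw [mul_inv]
  field_simp

lemma norm_unitInversion_sub {x y : E} (hx : x ≠ 0) (hy : y ≠ 0) :
    ‖unitInversion x - unitInversion y‖ = ‖x - y‖ / (‖x‖ * ‖y‖) := by
  have := EuclideanGeometry.dist_inversion_inversion hx hy 1
  rw [dist_eq_norm, dist_eq_norm, dist_eq_norm, dist_eq_norm, sub_zero, sub_zero] at this
  rw [unitInversion, unitInversion, this]
  ring

lemma image_unitInversion_puncturedBall :
    unitInversion '' puncturedBall E = (closedBall 0 1)ᶜ := by
  ext z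
  simp only [mem_image, mem_puncturedBall, mem_compl_iff, mem_closedBall, dist_zero_right, not_le]
  constructor
  · rintro ⟨x, ⟨h1, h0⟩, rfl⟩
    rw [norm_unitInversion]
    exact (one_lt_inv₀ (norm_pos_iff.2 h0)).2 h1
  · intro hz
    have hz0 : z ≠ 0 := norm_pos_iff.1 (zero_lt_one.trans hz)
    exact ⟨unitInversion z, ⟨by rw [norm_unitInversion]; exact inv_lt_one_of_one_lt₀ hz,
      unitInversion_ne_zero hz0⟩, unitInversion_unitInversion z⟩

variable [FiniteDimensional ℝ E]

/-- The derivative is `‖x‖⁻²` times a hyperplane reflection, whose determinant has absolute value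
one. -/
lemma exists_fderiv_unitInversion {x : E} (hx : x ≠ 0) :
    ∃ A : E →L[ℝ] E, HasFDerivAt unitInversion A x ∧
      |A.det| = ‖x‖ ^ (-(2 * (finrank ℝ E : ℝ))) := by
  refine ⟨_, EuclideanGeometry.hasFDerivAt_inversion hx, ?_⟩
  have h := Submodule.det_reflection ((ℝ ∙ (x - 0))ᗮ : Submodule ℝ E)
  rw [ContinuousLinearMap.det]
  rw [ContinuousLinearMap.toLinearMap_smul, LinearMap.det_smul, abs_mul]
  have h2 : |LinearMap.det (((((ℝ ∙ (x - 0))ᗮ : Submodule ℝ E).reflection : E →L[ℝ] E)) : E →ₗ[ℝ] E)|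
      = 1 := by
    erw [h]
    simp
  rw [h2, mul_one, dist_zero_right, abs_of_nonneg (by positivity), one_div, inv_pow, inv_pow,
    ← pow_mul, Real.rpow_neg (norm_nonneg x), ← Real.rpow_natCast]
  push_cast
  rfl

variable [MeasurableSpace E] [BorelSpace E]

/-- Integrals over the whole space fold onto the unit ball. -/
lemma integral_eq_integral_puncturedBall_add [Nontrivial E] {f : E → ℝ} (hf : Integrable f) :
    IntegrableOn f (puncturedBall E) ∧
    IntegrableOn (fun y => ‖y‖ ^ (-(2 * (finrank ℝ E : ℝ))) * f (unitInversion y))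
      (puncturedBall E) ∧
    ∫ y, f y = (∫ y in puncturedBall E, f y) +
      ∫ y in puncturedBall E, ‖y‖ ^ (-(2 * (finrank ℝ E : ℝ))) * f (unitInversion y) := by
  classical
  choose! A hA hdet using fun (x : E) (hx : x ≠ 0) => exists_fderiv_unitInversion hx
  have hder : ∀ x ∈ puncturedBall E,
      HasFDerivWithinAt unitInversion (A x) (puncturedBall E) x :=
    fun x hx => (hA x (mem_puncturedBall.1 hx).2).hasFDerivWithinAt
  have hinj : InjOn unitInversion (puncturedBall E) :=
    (Function.LeftInverse.injective (g := unitInversion) unitInversion_unitInversion).injOn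
  have hcongr : EqOn (fun y => |(A y).det| • f (unitInversion y))
      (fun y => ‖y‖ ^ (-(2 * (finrank ℝ E : ℝ))) * f (unitInversion y)) (puncturedBall E) :=
    fun y hy => by simp only [smul_eq_mul, hdet y (mem_puncturedBall.1 hy).2]
  have hint := integral_image_eq_integral_abs_det_fderiv_smul volume measurableSet_puncturedBall
    hder hinj f
  have hio := (integrableOn_image_iff_integrableOn_abs_det_fderiv_smul volume
    measurableSet_puncturedBall hder hinj f).1 hf.integrableOn
  rw [setIntegral_congr_fun measurableSet_puncturedBall hcongr,
    image_unitInversion_puncturedBall] at hint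
  refine ⟨hf.integrableOn, hio.congr_fun hcongr measurableSet_puncturedBall, ?_⟩
  rw [← hint, ← integral_add_compl measurableSet_closedBall hf]
  congr 1
  apply setIntegral_congr_set
  have h1 : (closedBall (0 : E) 1 : Set E) =ᵐ[volume] ball (0 : E) 1 :=
    (ae_eq_of_subset_of_measure_ge ball_subset_closedBall
      (Measure.addHaar_closedBall_eq_addHaar_ball volume 0 1).le
      measurableSet_ball.nullMeasurableSet measure_closedBall_lt_top.ne).symm
  exact h1.trans (sdiff_null_ae_eq_self (measure_singleton _)).symm

end Inversion

/-! ### Reflected kernels and Kelvin transforms of potentials. -/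

section Kernel

lemma one_sub_sq_norm_pos {E : Type*} [NormedAddCommGroup E] {x : E} (hx : ‖x‖ < 1) : 0 < 1 - ‖x‖ ^ 2 := by
  nlinarith [norm_nonneg x]

variable {E : Type*} [NormedAddCommGroup E] [InnerProductSpace ℝ E]

lemma norm_mul_norm_sub_unitInversion_comm {x y : E} (hx : x ≠ 0) (hy : y ≠ 0) :
    ‖y‖ * ‖x - unitInversion y‖ = ‖x‖ * ‖unitInversion x - y‖ := by
  have h := norm_unitInversion_sub hx (unitInversion_ne_zero hy)
  rw [unitInversion_unitInversion, norm_unitInversion] at h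
  rw [h]
  have := norm_ne_zero_iff.2 hx
  have := norm_ne_zero_iff.2 hy
  field_simp

/-- The last product is positive for two points of the open ball; this is why the kernel dominates
its reflection there. -/
lemma sq_norm_mul_norm_sub_unitInversion (x : E) {y : E} (hy : y ≠ 0) :
    (‖y‖ * ‖x - unitInversion y‖) ^ 2 = ‖x - y‖ ^ 2 + (1 - ‖x‖ ^ 2) * (1 - ‖y‖ ^ 2) := by
  have hy' := norm_ne_zero_iff.2 hy
  rw [mul_pow, norm_sub_sq_real, norm_sub_sq_real, norm_unitInversion, unitInversion_eq,
    inner_smul_right]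
  field_simp
  ring

/-- The kernel `‖x - y‖ ^ (-N)` reflected in the unit sphere. -/
noncomputable def reflectedKernel (N : ℝ) (x y : E) : ℝ :=
  (‖y‖ * ‖x - unitInversion y‖) ^ (-N)

lemma reflectedKernel_nonneg (N : ℝ) (x y : E) : 0 ≤ reflectedKernel N x y :=
  Real.rpow_nonneg (by positivity) _

lemma reflectedKernel_le {N : ℝ} (hN : 0 < N) {x y : E} (hx : ‖x‖ < 1) (hy : ‖y‖ < 1)
    (hy0 : y ≠ 0) (hxy : x ≠ y) : reflectedKernel N x y ≤ ‖x - y‖ ^ (-N) := by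
  refine Real.rpow_le_rpow_of_nonpos (norm_pos_iff.2 (sub_ne_zero.2 hxy)) ?_ (by linarith)
  refine (sq_le_sq₀ (by positivity) (by positivity)).1 ?_
  rw [sq_norm_mul_norm_sub_unitInversion x hy0]
  nlinarith [mul_pos (one_sub_sq_norm_pos hx) (one_sub_sq_norm_pos hy)]

/-- Away from the unit sphere the kernel exceeds its reflection by a definite amount. -/
lemma exists_pos_le_sub_reflectedKernel {N : ℝ} (hN : 0 < N) {r s : ℝ} (hr : 0 ≤ r) (hr1 : r < 1)
    (hs : 0 ≤ s) (hs1 : s < 1) : ∃ η > 0, ∀ x y : E, ‖x‖ ≤ r → ‖y‖ ≤ s → y ≠ 0 → x ≠ y →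
      η ≤ ‖x - y‖ ^ (-N) - reflectedKernel N x y := by
  set e : ℝ := (1 - r ^ 2) * (1 - s ^ 2) with he
  have hr2 : 0 < 1 - r ^ 2 := by nlinarith
  have hs2 : 0 < 1 - s ^ 2 := by nlinarith
  have he0 : 0 < e := mul_pos hr2 hs2
  have he1 : e ≤ 1 := by nlinarith [sq_nonneg r, sq_nonneg s]
  -- Below, `A² ≤ B² - e` and `B² ≤ 9`, so `A² ≤ (1 - e / 9) B²`, that is `A ≤ q B` with `q < 1`.
  set q : ℝ := Real.sqrt (1 - e / 9) with hq
  have hq2 : q ^ 2 = 1 - e / 9 := Real.sq_sqrt (by linarith)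
  have hq0 : 0 < q := Real.sqrt_pos.2 (by linarith)
  have hq1 : q < 1 := by nlinarith
  have hqN : 1 < q ^ (-N) := Real.one_lt_rpow_of_pos_of_lt_one_of_neg hq0 hq1 (by linarith)
  refine ⟨3 ^ (-N) * (q ^ (-N) - 1), mul_pos (by positivity) (by linarith), ?_⟩
  intro x y hx hy hy0 hxy
  set A := ‖x - y‖ with hA
  set B := ‖y‖ * ‖x - unitInversion y‖ with hB
  have hA0 : 0 < A := norm_pos_iff.2 (sub_ne_zero.2 hxy)
  have hB0 : 0 ≤ B := by positivity
  have hAB : B ^ 2 = A ^ 2 + (1 - ‖x‖ ^ 2) * (1 - ‖y‖ ^ 2) :=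
    sq_norm_mul_norm_sub_unitInversion x hy0
  have hx2 : ‖x‖ ^ 2 ≤ r ^ 2 := by gcongr
  have hy2 : ‖y‖ ^ 2 ≤ s ^ 2 := by gcongr
  have hA2 : A ≤ 2 := (norm_sub_le x y).trans (by linarith)
  have hlow : e ≤ (1 - ‖x‖ ^ 2) * (1 - ‖y‖ ^ 2) := by
    rw [he]; gcongr
    linarith
  have hup : (1 - ‖x‖ ^ 2) * (1 - ‖y‖ ^ 2) ≤ 1 := by
    nlinarith [sq_nonneg ‖x‖, sq_nonneg ‖y‖]
  have hB3 : B ≤ 3 := by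
    refine (sq_le_sq₀ hB0 (by norm_num)).1 ?_
    nlinarith
  have hBpos : 0 < B := by
    refine lt_of_le_of_ne hB0 fun h => ?_
    rw [← h] at hAB
    nlinarith
  have hAq : A ≤ q * B := by
    refine (sq_le_sq₀ (by positivity) (by positivity)).1 ?_
    rw [mul_pow, hq2]
    have : B ^ 2 ≤ 9 := by nlinarith
    nlinarith [mul_nonneg he0.le (sub_nonneg.2 this)]
  have h1 : (q * B) ^ (-N) ≤ A ^ (-N) := Real.rpow_le_rpow_of_nonpos hA0 hAq (by linarith)
  rw [Real.mul_rpow hq0.le hB0] at h1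
  have h2 : (3 : ℝ) ^ (-N) ≤ B ^ (-N) := Real.rpow_le_rpow_of_nonpos hBpos hB3 (by linarith)
  have h3 : (3 : ℝ) ^ (-N) * (q ^ (-N) - 1) ≤ B ^ (-N) * (q ^ (-N) - 1) := by
    gcongr
  have h4 : reflectedKernel N x y = B ^ (-N) := rfl
  rw [h4]
  linarith

/-- The Kelvin transform of `v` with respect to the unit sphere. -/
noncomputable def kelvinTransform (N : ℝ) (v : E → ℝ) (x : E) : ℝ :=
  ‖x‖ ^ (-N) * v (unitInversion x)

lemma kelvinTransform_nonneg (N : ℝ) {v : E → ℝ} (hv : ∀ x, 0 ≤ v x) (x : E) :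
    0 ≤ kelvinTransform N v x :=
  mul_nonneg (Real.rpow_nonneg (norm_nonneg x) _) (hv _)

/-- The transform with dual weight `2d - N` reproduces the nonlinearity up to the power `‖y‖ ^
(-τ)`. For `τ ≥ 0` this factor is at least one in the ball; this is how subcriticality enters. -/
lemma rpow_kelvinTransform {N a p d : ℝ} {v : E → ℝ} (hv : ∀ x, 0 ≤ v x) {y : E} (hy : y ≠ 0) :
    kelvinTransform (2 * d - N) (fun z => ‖z‖ ^ a * v z ^ p) y =
      ‖y‖ ^ a * ‖y‖ ^ (-(2 * d + 2 * a - N - N * p)) * kelvinTransform N v y ^ p := by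
  have hy' := norm_pos_iff.2 hy
  simp only [kelvinTransform]
  rw [Real.mul_rpow (by positivity) (hv _), norm_unitInversion, Real.inv_rpow (norm_nonneg y),
    ← Real.rpow_neg (norm_nonneg y), ← Real.rpow_mul (norm_nonneg y), ← mul_assoc, ← mul_assoc,
    ← Real.rpow_add hy', ← Real.rpow_add hy', ← Real.rpow_add hy']
  congr 2
  ring

lemma le_rpow_kelvinTransform {N a p d s : ℝ} {v : E → ℝ} (hv : ∀ x, 0 ≤ v x)
    (hτ : 0 ≤ 2 * d + 2 * a - N - N * p) {y : E} (hy : y ≠ 0) (hys : ‖y‖ ≤ s) :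
    ‖y‖ ^ a * s ^ (-(2 * d + 2 * a - N - N * p)) * kelvinTransform N v y ^ p ≤
      kelvinTransform (2 * d - N) (fun z => ‖z‖ ^ a * v z ^ p) y := by
  rw [rpow_kelvinTransform hv hy]
  have h1 : s ^ (-(2 * d + 2 * a - N - N * p)) ≤ ‖y‖ ^ (-(2 * d + 2 * a - N - N * p)) :=
    Real.rpow_le_rpow_of_nonpos (norm_pos_iff.2 hy) hys (by linarith)
  have h2 : 0 ≤ kelvinTransform N v y ^ p := Real.rpow_nonneg (kelvinTransform_nonneg N hv y) _
  gcongr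

variable [FiniteDimensional ℝ E] [MeasurableSpace E] [BorelSpace E]

/-- `v` is the potential `c ∫ h(y) / ‖x - y‖ ^ N dy` of `h`. -/
def IsPotential (N c : ℝ) (h v : E → ℝ) : Prop :=
  ∀ x, Integrable (fun y => ‖x - y‖ ^ (-N) * h y) volume ∧
    v x = c * ∫ y, ‖x - y‖ ^ (-N) * h y

/-- The difference of a potential and its Kelvin transform as an integral over the unit ball. -/
lemma IsPotential.kelvinTransform_sub [Nontrivial E] {N c : ℝ} {h v : E → ℝ}
    (hv : IsPotential N c h v) {x : E} (hx : x ≠ 0) :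
    IntegrableOn (fun y => (‖x - y‖ ^ (-N) - reflectedKernel N x y) *
      (kelvinTransform (2 * finrank ℝ E - N) h y - h y)) (puncturedBall E) ∧
    kelvinTransform N v x - v x = c * ∫ y in puncturedBall E,
      (‖x - y‖ ^ (-N) - reflectedKernel N x y) *
      (kelvinTransform (2 * finrank ℝ E - N) h y - h y) := by
  set d : ℝ := (finrank ℝ E : ℝ) with hd
  have hx' := norm_pos_iff.2 hx
  obtain ⟨i1, i2, e1⟩ := integral_eq_integral_puncturedBall_add (hv x).1
  obtain ⟨i3, i4, e2⟩ := integral_eq_integral_puncturedBall_add (hv (unitInversion x)).1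
  -- The Jacobian `‖y‖ ^ (-2d)` is shared out: `‖y‖ ^ (-N)` goes to the kernel and `‖y‖ ^ (-(2d -
  -- N))` to the transform of the source.
  have c2 : EqOn (fun y => ‖y‖ ^ (-(2 * d)) * (‖x - unitInversion y‖ ^ (-N) * h (unitInversion y)))
      (fun y => reflectedKernel N x y * kelvinTransform (2 * d - N) h y) (puncturedBall E) := by
    intro y hy
    have hy' := norm_pos_iff.2 (mem_puncturedBall.1 hy).2
    simp only [reflectedKernel, kelvinTransform]
    rw [Real.mul_rpow (norm_nonneg _) (norm_nonneg _),
      show -(2 * d) = -N + -(2 * d - N) by ring, Real.rpow_add hy']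
    ring
  have c3 : EqOn (fun y => ‖x‖ ^ (-N) * (‖unitInversion x - y‖ ^ (-N) * h y))
      (fun y => reflectedKernel N x y * h y) (puncturedBall E) := by
    intro y hy
    simp only [reflectedKernel]
    rw [norm_mul_norm_sub_unitInversion_comm hx (mem_puncturedBall.1 hy).2,
      Real.mul_rpow (norm_nonneg _) (norm_nonneg _)]
    ring
  have c4 : EqOn (fun y => ‖x‖ ^ (-N) * (‖y‖ ^ (-(2 * d)) *
        (‖unitInversion x - unitInversion y‖ ^ (-N) * h (unitInversion y))))
      (fun y => ‖x - y‖ ^ (-N) * kelvinTransform (2 * d - N) h y) (puncturedBall E) := by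
    intro y hy
    have hy0 := (mem_puncturedBall.1 hy).2
    have hy' := norm_pos_iff.2 hy0
    simp only [kelvinTransform]
    rw [norm_unitInversion_sub hx hy0, Real.div_rpow (norm_nonneg _) (by positivity),
      Real.mul_rpow hx'.le hy'.le, show -(2 * d) = -N + -(2 * d - N) by ring, Real.rpow_add hy']
    have := (Real.rpow_pos_of_pos hx' (-N)).ne'
    have := (Real.rpow_pos_of_pos hy' (-N)).ne'
    field_simp
  have hmB := measurableSet_puncturedBall (E := E)
  rw [setIntegral_congr_fun hmB c2] at e1
  have e2' : kelvinTransform N v x = c * ((∫ y in puncturedBall E, reflectedKernel N x y * h y) +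
      ∫ y in puncturedBall E, ‖x - y‖ ^ (-N) * kelvinTransform (2 * d - N) h y) := by
    rw [kelvinTransform, (hv (unitInversion x)).2, e2, mul_left_comm, mul_add,
      ← integral_const_mul, ← integral_const_mul, setIntegral_congr_fun hmB c3,
      setIntegral_congr_fun hmB c4]
  have j2 := i2.congr_fun c2 hmB
  have j3 := IntegrableOn.congr_fun (i3.const_mul (‖x‖ ^ (-N))) c3 hmB
  have j4 := IntegrableOn.congr_fun (i4.const_mul (‖x‖ ^ (-N))) c4 hmB
  have hG : (fun y => (‖x - y‖ ^ (-N) - reflectedKernel N x y) *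
      (kelvinTransform (2 * d - N) h y - h y)) =
      fun y => (reflectedKernel N x y * h y + ‖x - y‖ ^ (-N) * kelvinTransform (2 * d - N) h y) -
        (‖x - y‖ ^ (-N) * h y + reflectedKernel N x y * kelvinTransform (2 * d - N) h y) := by
    funext y; ring
  rw [hG]
  refine ⟨(j3.add j4).sub (i1.add j2), ?_⟩
  have s1 := integral_sub (j3.add j4) (i1.add j2)
  have s2 := integral_add j3 j4
  have s3 := integral_add i1 j2
  simp only [Pi.add_apply] at s1
  rw [s1, s2, s3, e2', (hv x).2, e1]
  ring

end Kernel

/-! ### Uniform bounds for integrals of the Riesz kernel. -/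

section RieszIntegrals

lemma measurable_norm_sub_rpow {E : Type*} [NormedAddCommGroup E] [MeasurableSpace E]
    [BorelSpace E] (N : ℝ) (x : E) : Measurable fun y => ‖x - y‖ ^ (-N) := by
  fun_prop

variable {E : Type*} [NormedAddCommGroup E] [InnerProductSpace ℝ E]
  [FiniteDimensional ℝ E] [MeasurableSpace E] [BorelSpace E]

lemma integrableOn_norm_rpow_ball [Nontrivial E] {N : ℝ} (hN : N < finrank ℝ E) :
    IntegrableOn (fun z : E => ‖z‖ ^ (-N)) (ball 0 1) := by
  have h := (integrableOn_fun_norm_addHaar (E := E) volume (f := fun t : ℝ => t ^ (-N)) (r := 1)).2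
  apply h
  have hd : 1 ≤ finrank ℝ E := Nat.one_le_iff_ne_zero.2 finrank_pos.ne'
  have h1 : IntegrableOn (fun t : ℝ => t ^ ((finrank ℝ E : ℝ) - 1 - N)) (Ioo 0 1) := by
    rw [intervalIntegral.integrableOn_Ioo_rpow_iff one_pos]
    linarith
  refine h1.congr_fun (fun t ht => ?_) measurableSet_Ioo
  simp only [smul_eq_mul]
  rw [← Real.rpow_natCast, ← Real.rpow_add ht.1]
  congr 1
  push_cast [hd]
  ring

/-- Beyond distance one the kernel is at most one. The near part is the integral of one fixed
function over a translated and reflected copy of `D`, which makes later bounds uniform in `x`. -/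
lemma lintegral_norm_sub_rpow_le {N : ℝ} (hN0 : 0 < N) {D : Set E}
    (hD : MeasurableSet D) (x : E) :
    ∫⁻ y in D, ENNReal.ofReal (‖x - y‖ ^ (-N)) ≤
      (∫⁻ z in (fun z => x - z) ⁻¹' D, (ball 0 1).indicator
        (fun z => ENNReal.ofReal (‖z‖ ^ (-N))) z) + volume D := by
  set g : E → ENNReal := (ball 0 1).indicator (fun z => ENNReal.ofReal (‖z‖ ^ (-N))) with hg
  have hle : ∀ y, ENNReal.ofReal (‖x - y‖ ^ (-N)) ≤ g (x - y) + 1 := by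
    intro y
    by_cases h : x - y ∈ ball (0 : E) 1
    · rw [hg, indicator_of_mem h]
      exact le_self_add
    · rw [hg, indicator_of_notMem h, zero_add]
      rw [mem_ball_zero_iff, not_lt] at h
      exact ENNReal.ofReal_le_one.2 (Real.rpow_le_one_of_one_le_of_nonpos h (by linarith))
  have hgm : Measurable g := by
    refine Measurable.indicator ?_ measurableSet_ball
    fun_prop
  have hpre : MeasurableSet ((fun z => x - z) ⁻¹' D) :=
    hD.preimage (by fun_prop)
  calc ∫⁻ y in D, ENNReal.ofReal (‖x - y‖ ^ (-N))
      ≤ ∫⁻ y in D, (g (x - y) + 1) := lintegral_mono hle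
    _ = (∫⁻ y in D, g (x - y)) + volume D := by
        rw [lintegral_add_right _ measurable_const]
        simp
    _ = _ := by
        congr 1
        rw [← lintegral_indicator hD, ← lintegral_indicator hpre,
          ← lintegral_sub_left_eq_self (fun z => ((fun z => x - z) ⁻¹' D).indicator g z) x]
        congr 1
        funext y
        have hiff : x - y ∈ (fun z => x - z) ⁻¹' D ↔ y ∈ D := by
          rw [mem_preimage, sub_sub_cancel]
        by_cases hy : y ∈ D
        · rw [indicator_of_mem hy, indicator_of_mem (hiff.2 hy)]
        · rw [indicator_of_notMem hy, indicator_of_notMem (mt hiff.1 hy)]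

lemma lintegral_indicator_norm_rpow_ne_top [Nontrivial E] {N : ℝ} (hN : N < finrank ℝ E) :
    ∫⁻ z : E, (ball 0 1).indicator (fun z => ENNReal.ofReal (‖z‖ ^ (-N))) z ≠ ⊤ := by
  rw [lintegral_indicator measurableSet_ball]
  exact ((hasFiniteIntegral_iff_ofReal (ae_of_all _ fun z => by positivity)).1
    (integrableOn_norm_rpow_ball hN).2).ne

lemma integrableOn_norm_sub_rpow [Nontrivial E] {N : ℝ} (hN0 : 0 < N) (hN : N < finrank ℝ E)
    {D : Set E} (hD : MeasurableSet D) (hfin : volume D ≠ ⊤) (x : E) :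
    IntegrableOn (fun y => ‖x - y‖ ^ (-N)) D := by
  refine ⟨(measurable_norm_sub_rpow N x).aestronglyMeasurable, ?_⟩
  rw [hasFiniteIntegral_iff_ofReal (ae_of_all _ fun z => by positivity)]
  refine (lintegral_norm_sub_rpow_le hN0 hD x).trans_lt (ENNReal.add_lt_top.2 ⟨?_, hfin.lt_top⟩)
  exact (setLIntegral_le_lintegral _ _).trans_lt (lintegral_indicator_norm_rpow_ne_top hN).lt_top

lemma exists_integral_norm_sub_rpow_le [Nontrivial E] {N : ℝ} (hN0 : 0 < N)
    (hN : N < finrank ℝ E) {D : Set E} (hD : MeasurableSet D) (hfin : volume D ≠ ⊤) :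
    ∃ K : ℝ, ∀ x : E, ∫ y in D, ‖x - y‖ ^ (-N) ≤ K := by
  refine ⟨((∫⁻ z : E, (ball 0 1).indicator (fun z => ENNReal.ofReal (‖z‖ ^ (-N))) z) +
    volume D).toReal, fun x => ?_⟩
  rw [integral_eq_lintegral_of_nonneg_ae (ae_of_all _ fun z => by positivity)
    (measurable_norm_sub_rpow N x).aestronglyMeasurable]
  exact ENNReal.toReal_mono (ENNReal.add_ne_top.2 ⟨lintegral_indicator_norm_rpow_ne_top hN, hfin⟩)
    ((lintegral_norm_sub_rpow_le hN0 hD x).trans (add_le_add_left (setLIntegral_le_lintegral _ _) _))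

/-- Riesz kernels are uniformly integrable with respect to translations. -/
lemma exists_pos_integral_norm_sub_rpow_le [Nontrivial E] {N : ℝ} (hN0 : 0 < N)
    (hN : N < finrank ℝ E) {ε : ℝ} (hε : 0 < ε) :
    ∃ δ : ENNReal, 0 < δ ∧ ∀ D : Set E, MeasurableSet D → volume D < δ → ∀ x : E,
      ∫ y in D, ‖x - y‖ ^ (-N) ≤ ε := by
  have hε2 : ENNReal.ofReal (ε / 2) ≠ 0 := (ENNReal.ofReal_pos.2 (half_pos hε)).ne'
  obtain ⟨δ, hδ0, hδ⟩ := exists_pos_setLIntegral_lt_of_measure_lt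
    (lintegral_indicator_norm_rpow_ne_top (E := E) hN) hε2
  refine ⟨min δ (ENNReal.ofReal (ε / 2)), lt_min hδ0 hε2.bot_lt, fun D hD hvol x => ?_⟩
  rw [integral_eq_lintegral_of_nonneg_ae (ae_of_all _ fun z => by positivity)
    (measurable_norm_sub_rpow N x).aestronglyMeasurable]
  refine ENNReal.toReal_le_of_le_ofReal hε.le ?_
  have hpre : volume ((fun z => x - z) ⁻¹' D) = volume D :=
    (Measure.measurePreserving_sub_left volume x).measure_preimage hD.nullMeasurableSet
  refine (lintegral_norm_sub_rpow_le hN0 hD x).trans ?_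
  calc _ ≤ ENNReal.ofReal (ε / 2) + ENNReal.ofReal (ε / 2) :=
        add_le_add (hδ _ (hpre ▸ hvol.trans_le (min_le_left _ _))).le
          (hvol.le.trans (min_le_right _ _))
    _ = ENNReal.ofReal ε := by
        rw [← ENNReal.ofReal_add (by positivity) (by positivity), add_halves]

end RieszIntegrals

/-! ### Maximum principles for the gap between a solution and its Kelvin transform. -/

section Comparison

lemma mul_measureReal_le_setIntegral {X : Type*} [MeasurableSpace X] {μ : Measure X} {f : X → ℝ}
    {s A : Set X} {κ : ℝ} (hf : IntegrableOn f s μ) (hs : MeasurableSet s) (hA : MeasurableSet A)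
    (hAs : A ⊆ s) (hAfin : μ A ≠ ⊤) (h0 : ∀ᵐ y ∂μ, y ∈ s → 0 ≤ f y)
    (hκ : ∀ᵐ y ∂μ, y ∈ A → κ ≤ f y) : κ * μ.real A ≤ ∫ y in s, f y ∂μ := by
  calc κ * μ.real A = ∫ _ in A, κ ∂μ := by rw [setIntegral_const, smul_eq_mul, mul_comm]
    _ ≤ ∫ y in A, f y ∂μ :=
        setIntegral_mono_on_ae (integrableOn_const hAfin) (hf.mono_set hAs) hA hκ
    _ ≤ ∫ y in s, f y ∂μ :=
        setIntegral_mono_set hf ((ae_restrict_iff' hs).2 h0) hAs.eventuallyLE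

/-- Bernoulli's inequality at `s / t - 1`, multiplied by `t ^ p`. -/
lemma rpow_sub_rpow_le {s t p : ℝ} (hs : 0 ≤ s) (hst : s ≤ t) (hp : 1 ≤ p) :
    t ^ p - s ^ p ≤ p * t ^ (p - 1) * (t - s) := by
  rcases (hs.trans hst).eq_or_lt with ht | ht
  · have : s = 0 := by linarith
    subst this
    simp [← ht]
  have h := one_add_mul_self_le_rpow_one_add (s := s / t - 1)
    (by linarith [div_nonneg hs ht.le]) hp
  rw [add_sub_cancel, Real.div_rpow hs ht.le, le_div_iff₀ (by positivity)] at h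
  have h1 : t ^ p = t ^ (p - 1) * t := by
    rw [← Real.rpow_add_one ht.ne']; congr 1; ring
  have h2 : (1 + p * (s / t - 1)) * t ^ p = t ^ p - p * t ^ (p - 1) * (t - s) := by
    rw [h1]; field_simp; ring
  linarith

variable {E : Type*} [NormedAddCommGroup E] [InnerProductSpace ℝ E]
  [FiniteDimensional ℝ E] [MeasurableSpace E] [BorelSpace E]

lemma ae_ne [Nontrivial E] (x : E) : ∀ᵐ y : E, x ≠ y := by
  filter_upwards [compl_mem_ae_iff.2 (measure_singleton (μ := volume) x)] with y hy
  exact fun h => hy h.symm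

lemma IsPotential.mul_measureReal_ball_le [Nontrivial E] {N c : ℝ} {h v : E → ℝ}
    (hv : IsPotential N c h v)
    (hN : 0 < N) (hc : 0 ≤ c) (hh : ∀ y, 0 ≤ h y) {x z : E} {r R m : ℝ} (hm : 0 ≤ m)
    (hmh : ∀ y ∈ ball z r, m ≤ h y) (hR : ∀ y ∈ ball z r, ‖x - y‖ ≤ R) :
    c * (R ^ (-N) * m * volume.real (ball z r)) ≤ v x := by
  rw [(hv x).2, ← setIntegral_univ]
  refine mul_le_mul_of_nonneg_left (mul_measureReal_le_setIntegral (hv x).1.integrableOn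
    MeasurableSet.univ measurableSet_ball (subset_univ _) measure_ball_lt_top.ne
    (ae_of_all _ fun y _ => mul_nonneg (by positivity) (hh y)) ?_) hc
  filter_upwards [ae_ne x] with y hxy hy
  exact mul_le_mul (Real.rpow_le_rpow_of_nonpos (norm_pos_iff.2 (sub_ne_zero.2 hxy)) (hR y hy)
    (by linarith)) (hmh y hy) hm (by positivity)

/-- Maximum principle in regions on which the Riesz kernel has a small integral. -/
lemma IsPotential.le_kelvinTransform_of_integral_le [Nontrivial E] {N c a p U : ℝ} {v : E → ℝ}
    (hv : IsPotential N c (fun y => ‖y‖ ^ a * v y ^ p) v) (hN : 0 < N) (hNd : N < finrank ℝ E)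
    (hc : 0 ≤ c) (ha : 0 ≤ a) (hp : 1 ≤ p)
    (hτ : 0 ≤ 2 * finrank ℝ E + 2 * a - N - N * p)
    (hv0 : ∀ x, 0 ≤ v x) (hU : ∀ y ∈ puncturedBall E, v y ≤ U)
    {D : Set E} (hD : MeasurableSet D) (hDB : D ⊆ puncturedBall E)
    (hBD : ∀ y ∈ puncturedBall E \ D, v y ≤ kelvinTransform N v y)
    (hsmall : ∀ x, c * (p * U ^ (p - 1)) * ∫ y in D, ‖x - y‖ ^ (-N) ≤ 1 / 2) :
    ∀ x ∈ puncturedBall E, v x ≤ kelvinTransform N v x := by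
  set d : ℝ := (finrank ℝ E : ℝ) with hd
  have hDfin : volume D ≠ ⊤ :=
    ((measure_mono (hDB.trans sdiff_subset)).trans_lt measure_ball_lt_top).ne
  -- Any upper bound for the deficit can be halved; iterating from the bound `U` removes the need
  -- for a point where the supremum is attained.
  have step : ∀ M, 0 ≤ M → (∀ y ∈ puncturedBall E, v y - kelvinTransform N v y ≤ M) →
      ∀ x ∈ puncturedBall E, v x - kelvinTransform N v x ≤ M / 2 := by
    intro M hM hyp x hx
    obtain ⟨hx1, hx0⟩ := mem_puncturedBall.1 hx
    have hU0 : 0 ≤ U := (hv0 x).trans (hU x hx)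
    obtain ⟨hint, heq⟩ := hv.kelvinTransform_sub hx0
    rw [← hd] at hint heq
    set L : ℝ := p * U ^ (p - 1) * M with hL
    have hL0 : 0 ≤ L := by positivity
    have hker := integrableOn_norm_sub_rpow hN hNd hD hDfin x
    have hind : IntegrableOn (D.indicator fun y => -L * ‖x - y‖ ^ (-N)) (puncturedBall E) :=
      ((integrable_indicator_iff hD).2 (hker.const_mul (-L))).integrableOn
    have hmono : ∫ y in puncturedBall E, D.indicator (fun y => -L * ‖x - y‖ ^ (-N)) y ≤
        ∫ y in puncturedBall E, (‖x - y‖ ^ (-N) - reflectedKernel N x y) *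
          (kelvinTransform (2 * d - N) (fun y => ‖y‖ ^ a * v y ^ p) y - ‖y‖ ^ a * v y ^ p) := by
      refine setIntegral_mono_on_ae hind hint measurableSet_puncturedBall ?_
      filter_upwards [ae_ne x] with y hxy hy
      obtain ⟨hy1, hy0⟩ := mem_puncturedBall.1 hy
      have hk0 := reflectedKernel_nonneg N x y
      have hk1 := reflectedKernel_le hN hx1 hy1 hy0 hxy
      have hkel := le_rpow_kelvinTransform hv0 hτ hy0 hy1.le
      rw [Real.one_rpow, mul_one] at hkel
      have hya : ‖y‖ ^ a ≤ 1 := Real.rpow_le_one (norm_nonneg y) hy1.le ha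
      have hya0 : 0 ≤ ‖y‖ ^ a := by positivity
      have hK0 := kelvinTransform_nonneg N hv0 y
      rcases le_or_gt (v y) (kelvinTransform N v y) with hle | hlt
      · have h1 : v y ^ p ≤ kelvinTransform N v y ^ p :=
          Real.rpow_le_rpow (hv0 y) hle (by linarith)
        have h2 : ‖y‖ ^ a * v y ^ p ≤ ‖y‖ ^ a * kelvinTransform N v y ^ p := by gcongr
        refine le_trans ?_ (mul_nonneg (sub_nonneg.2 hk1) (sub_nonneg.2 (h2.trans hkel)))
        refine indicator_nonpos (fun z _ => ?_) y
        exact mul_nonpos_of_nonpos_of_nonneg (by linarith) (by positivity)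
      -- At a bad point the source difference is at least `-L`, and the kernel difference lies
      -- between `0` and `‖x - y‖ ^ (-N)`.
      · have hyD : y ∈ D := by
          by_contra hyD
          exact absurd (hBD y ⟨hy, hyD⟩) hlt.not_ge
        rw [indicator_of_mem hyD]
        have h1 := rpow_sub_rpow_le hK0 hlt.le hp
        have h2 : v y ^ (p - 1) ≤ U ^ (p - 1) :=
          Real.rpow_le_rpow (hv0 y) (hU y hy) (by linarith)
        have h3 : v y ^ p - kelvinTransform N v y ^ p ≤ L := by
          refine h1.trans ?_
          rw [hL]
          have := hyp y hy
          have : 0 ≤ v y - kelvinTransform N v y := by linarith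
          gcongr
        have h4 : ‖y‖ ^ a * (v y ^ p - kelvinTransform N v y ^ p) ≤ L :=
          (mul_le_mul_of_nonneg_left h3 hya0).trans (mul_le_of_le_one_left hL0 hya)
        nlinarith
    rw [setIntegral_indicator hD, inter_eq_self_of_subset_right hDB, integral_const_mul] at hmono
    have h5 := mul_le_mul_of_nonneg_left hmono hc
    rw [← heq] at h5
    have h6 := mul_le_mul_of_nonneg_right (hsmall x) hM
    have h7 : c * (-L * ∫ y in D, ‖x - y‖ ^ (-N)) =
      -(c * (p * U ^ (p - 1)) * (∫ y in D, ‖x - y‖ ^ (-N)) * M) := by rw [hL]; ring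
    linarith
  intro x hx
  have hU0 : 0 ≤ U := (hv0 x).trans (hU x hx)
  have hk : ∀ k : ℕ, ∀ y ∈ puncturedBall E, v y - kelvinTransform N v y ≤ U / 2 ^ k := by
    intro k
    induction k with
    | zero =>
      intro y hy
      have := kelvinTransform_nonneg N hv0 y
      have := hU y hy
      simp only [pow_zero, div_one]
      linarith
    | succ k ih =>
      intro y hy
      rw [pow_succ, ← div_div]
      exact step _ (by positivity) ih y hy
  have hlim : Tendsto (fun k : ℕ => U / 2 ^ k) atTop (𝓝 0) :=
    tendsto_const_nhds.div_atTop (tendsto_pow_atTop_atTop_of_one_lt one_lt_two)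
  have := ge_of_tendsto' hlim fun k => hk k x hx
  linarith

/-- Strong maximum principle: the gap is bounded below away from the unit sphere. -/
lemma IsPotential.exists_pos_le_kelvinTransform_sub [Nontrivial E] {N c a p : ℝ} {v : E → ℝ}
    (hv : IsPotential N c (fun y => ‖y‖ ^ a * v y ^ p) v) (hN : 0 < N)
    (hc : 0 < c) (ha : 0 ≤ a) (hp : 0 < p)
    (hτ : 0 < 2 * finrank ℝ E + 2 * a - N - N * p)
    (hvc : Continuous v) (hv0 : ∀ x, 0 < v x)
    (hle : ∀ y ∈ puncturedBall E, v y ≤ kelvinTransform N v y)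
    {r : ℝ} (hr : 0 ≤ r) (hr1 : r < 1) :
    ∃ C > 0, ∀ x : E, x ≠ 0 → ‖x‖ ≤ r → C ≤ kelvinTransform N v x - v x := by
  set d : ℝ := (finrank ℝ E : ℝ) with hd
  set τ : ℝ := 2 * d + 2 * a - N - N * p with hτd
  obtain ⟨η, hη, hker⟩ := exists_pos_le_sub_reflectedKernel (E := E) hN hr hr1
    (s := 3 / 4) (by norm_num) (by norm_num)
  obtain ⟨z, -, hz⟩ := (isCompact_closedBall (0 : E) 1).exists_isMinOn
    (nonempty_closedBall.2 zero_le_one) hvc.continuousOn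
  -- The ball of radius `1 / 4` about `e` avoids the origin, where the weight may vanish, and the
  -- unit sphere, where the kernel gap and the gain `‖y‖ ^ (-τ) - 1` degenerate.
  obtain ⟨e, he⟩ := exists_norm_eq E (c := 1 / 2) (by norm_num)
  have hq : 1 < (3 / 4 : ℝ) ^ (-τ) :=
    Real.one_lt_rpow_of_pos_of_lt_one_of_neg (by norm_num) (by norm_num) (by linarith)
  set κ : ℝ := (1 / 4) ^ a * ((3 / 4 : ℝ) ^ (-τ) - 1) * v z ^ p with hκ
  have hvz := hv0 z
  have hκ0 : 0 < κ := by
    have : 0 < (3 / 4 : ℝ) ^ (-τ) - 1 := by linarith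
    positivity
  have hA : ∀ y ∈ ball e (1 / 4), 1 / 4 ≤ ‖y‖ ∧ ‖y‖ ≤ 3 / 4 := by
    intro y hy
    rw [mem_ball_iff_norm] at hy
    have h1 := abs_norm_sub_norm_le y e
    rw [abs_le] at h1
    constructor <;> linarith [h1.1, h1.2]
  have hAB : ball e (1 / 4) ⊆ puncturedBall E := fun y hy =>
    mem_puncturedBall.2 ⟨(hA y hy).2.trans_lt (by norm_num),
      norm_pos_iff.1 (lt_of_lt_of_le (by norm_num) (hA y hy).1)⟩
  refine ⟨c * (η * κ * volume.real (ball e (1 / 4))),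
    mul_pos hc (mul_pos (mul_pos hη hκ0) (ENNReal.toReal_pos
      (measure_ball_pos _ _ (by norm_num)).ne' measure_ball_lt_top.ne)), ?_⟩
  intro x hx0 hxr
  obtain ⟨hint, heq⟩ := hv.kelvinTransform_sub hx0
  rw [← hd] at hint heq
  rw [heq]
  refine mul_le_mul_of_nonneg_left (mul_measureReal_le_setIntegral hint
    measurableSet_puncturedBall measurableSet_ball hAB measure_ball_lt_top.ne ?_ ?_) hc.le
  · filter_upwards [ae_ne x] with y hxy hy
    obtain ⟨hy1, hy0⟩ := mem_puncturedBall.1 hy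
    have hk1 := reflectedKernel_le hN (hxr.trans_lt hr1) hy1 hy0 hxy
    have hkel := le_rpow_kelvinTransform (fun x => (hv0 x).le) hτ.le hy0 hy1.le
    rw [Real.one_rpow, mul_one] at hkel
    have h1 : v y ^ p ≤ kelvinTransform N v y ^ p :=
      Real.rpow_le_rpow (hv0 y).le (hle y hy) hp.le
    have h2 : ‖y‖ ^ a * v y ^ p ≤ ‖y‖ ^ a * kelvinTransform N v y ^ p := by gcongr
    exact mul_nonneg (sub_nonneg.2 hk1) (sub_nonneg.2 (h2.trans hkel))
  · filter_upwards [ae_ne x] with y hxy hy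
    obtain ⟨hy1, hy0⟩ := mem_puncturedBall.1 (hAB hy)
    refine mul_le_mul (hker x y hxr (hA y hy).2 hy0 hxy) ?_ hκ0.le
      (sub_nonneg.2 (reflectedKernel_le hN (hxr.trans_lt hr1) hy1 hy0 hxy))
    have hkel := le_rpow_kelvinTransform (fun x => (hv0 x).le) hτ.le hy0 (hA y hy).2
    have h1 : v y ^ p ≤ kelvinTransform N v y ^ p :=
      Real.rpow_le_rpow (hv0 y).le (hle y (hAB hy)) hp.le
    have h2 : ‖y‖ ^ a * (3 / 4 : ℝ) ^ (-τ) * v y ^ p ≤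
        ‖y‖ ^ a * (3 / 4 : ℝ) ^ (-τ) * kelvinTransform N v y ^ p := by gcongr
    have h3 : v z ^ p ≤ v y ^ p :=
      Real.rpow_le_rpow hvz.le (hz (mem_closedBall_zero_iff.2 hy1.le)) hp.le
    have h4 : (1 / 4 : ℝ) ^ a ≤ ‖y‖ ^ a := Real.rpow_le_rpow (by norm_num) (hA y hy).1 ha
    have h5 : κ ≤ ‖y‖ ^ a * ((3 / 4 : ℝ) ^ (-τ) - 1) * v y ^ p := by
      have : 0 ≤ (3 / 4 : ℝ) ^ (-τ) - 1 := by linarith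
      rw [hκ]
      gcongr
    linarith

end Comparison

/-! ### Lower bounds at infinity and their bootstrap. -/

section LowerBounds

variable {E : Type*} [NormedAddCommGroup E] [InnerProductSpace ℝ E]
  [FiniteDimensional ℝ E] [MeasurableSpace E] [BorelSpace E] [Nontrivial E]
  {N c a p : ℝ} {u : E → ℝ}

/-- A nontrivial nonnegative solution decays at most like the Riesz kernel. -/
lemma IsPotential.exists_pos_lower_bound (hu : IsPotential N c (fun y => ‖y‖ ^ a * u y ^ p) u)
    (hN : 0 < N) (hc : 0 < c) (ha : 0 ≤ a) (hp : 0 < p) (huc : Continuous u)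
    (hu0 : ∀ x, 0 ≤ u x) {x₀ : E} (hx₀ : u x₀ ≠ 0) :
    ∃ C > 0, ∃ ρ > 0, ∀ x, C * (‖x‖ + ρ) ^ (-N) ≤ u x := by
  -- The point must avoid the origin, where `‖y‖ ^ a` vanishes if `a > 0`.
  obtain ⟨z, hz⟩ : ∃ z, z ∈ {y | u y ≠ 0} ∩ {(0 : E)}ᶜ :=
    (dense_compl_singleton (0 : E)).inter_open_nonempty _
      (isOpen_ne_fun huc continuous_const) ⟨x₀, hx₀⟩
  have huz : 0 < u z := (hu0 z).lt_of_ne' hz.1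
  have hz0 : 0 < ‖z‖ := norm_pos_iff.2 hz.2
  have hhz : 0 < ‖z‖ ^ a * u z ^ p := by positivity
  have hhc : Continuous fun y => ‖y‖ ^ a * u y ^ p :=
    (continuous_norm.rpow_const fun _ => Or.inr ha).mul (huc.rpow_const fun _ => Or.inr hp.le)
  obtain ⟨r, hr, hball⟩ := Metric.eventually_nhds_iff_ball.1
    (hhc.continuousAt.eventually (lt_mem_nhds (half_lt_self hhz)))
  have hV : 0 < volume.real (ball z r) :=
    ENNReal.toReal_pos (measure_ball_pos _ _ hr).ne' measure_ball_lt_top.ne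
  refine ⟨c * ((‖z‖ ^ a * u z ^ p / 2) * volume.real (ball z r)), by positivity, ‖z‖ + r,
    by positivity, fun x => ?_⟩
  have := hu.mul_measureReal_ball_le hN hc.le
    (fun y => mul_nonneg (by positivity) (Real.rpow_nonneg (hu0 y) _)) (x := x) (z := z) (r := r)
    (R := ‖x‖ + (‖z‖ + r)) (half_pos hhz).le (fun y hy => (hball y hy).le) (fun y hy => ?_)
  · refine le_trans (le_of_eq ?_) this
    ring
  · rw [mem_ball_iff_norm] at hy
    have h1 := norm_sub_le x y
    have h2 := norm_le_norm_add_norm_sub' y z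
    linarith

/-- One step of the bootstrap for lower bounds of a solution at infinity. -/
lemma IsPotential.exists_improved_lower_bound
    (hu : IsPotential N c (fun y => ‖y‖ ^ a * u y ^ p) u)
    (hN : 0 < N) (hc : 0 < c) (ha : 0 ≤ a) (hp : 0 < p) (hu0 : ∀ x, 0 ≤ u x) {C ν : ℝ}
    (hC : 0 < C) (hν : 0 ≤ ν) (hlow : ∀ x, 1 < ‖x‖ → C * ‖x‖ ^ (-ν) ≤ u x) :
    ∃ C' > 0, ∀ R, 1 < R → ∀ x, ‖x‖ ≤ R → C' * R ^ (a + finrank ℝ E - N - p * ν) ≤ u x := by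
  -- The ball of radius `R` about `R • e` lies in `R < ‖y‖ ≤ 3R` and within `4R` of every `x` with
  -- `‖x‖ ≤ R`; its volume supplies the factor `R ^ d`.
  obtain ⟨e, he⟩ := exists_norm_eq E (c := 2) (by norm_num)
  have hV : 0 < volume.real (ball (0 : E) 1) :=
    ENNReal.toReal_pos (measure_ball_pos _ _ one_pos).ne' measure_ball_lt_top.ne
  refine ⟨c * (4 ^ (-N) * (C ^ p * 3 ^ (-(p * ν))) * volume.real (ball (0 : E) 1)),
    by positivity, fun R hR x hx => ?_⟩
  have hR0 : 0 < R := one_pos.trans hR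
  have hy : ∀ y ∈ ball (R • e) R, R < ‖y‖ ∧ ‖y‖ ≤ 3 * R := by
    intro y hy
    rw [mem_ball_iff_norm] at hy
    have h1 := abs_norm_sub_norm_le y (R • e)
    rw [norm_smul, he, Real.norm_of_nonneg hR0.le, abs_le] at h1
    constructor <;> linarith [h1.1, h1.2]
  have key := hu.mul_measureReal_ball_le hN hc.le
    (fun y => mul_nonneg (by positivity) (Real.rpow_nonneg (hu0 y) _)) (x := x) (z := R • e)
    (r := R) (R := 4 * R) (m := R ^ a * (C * (3 * R) ^ (-ν)) ^ p) (by positivity)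
    (fun y hyb => ?_) (fun y hyb => ?_)
  · refine le_trans (le_of_eq ?_) key
    rw [← Measure.addHaar_real_closedBall_eq_addHaar_real_ball volume (R • e),
      Measure.addHaar_real_closedBall _ _ hR0.le, Real.mul_rpow (by norm_num) hR0.le,
      Real.mul_rpow hC.le (by positivity), ← Real.rpow_mul (by positivity),
      Real.mul_rpow (by norm_num) hR0.le, ← Real.rpow_natCast,
      show a + finrank ℝ E - N - p * ν = -N + (a + (-ν * p + finrank ℝ E)) by ring,
      Real.rpow_add hR0, Real.rpow_add hR0, Real.rpow_add hR0,
      show -ν * p = -(p * ν) by ring]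
    ring
  · obtain ⟨h1, h2⟩ := hy y hyb
    have h3 : (3 * R) ^ (-ν) ≤ ‖y‖ ^ (-ν) :=
      Real.rpow_le_rpow_of_nonpos (hR0.trans h1) h2 (by linarith)
    have h4 : C * (3 * R) ^ (-ν) ≤ u y :=
      (mul_le_mul_of_nonneg_left h3 hC.le).trans (hlow y (hR.trans h1))
    exact mul_le_mul (Real.rpow_le_rpow hR0.le h1.le ha)
      (Real.rpow_le_rpow (by positivity) h4 hp.le) (by positivity) (by positivity)
  · have h1 := norm_sub_le x y
    linarith [(hy y hyb).2]

/-- A nonnegative solution cannot decay slower than the scaling-invariant rate. -/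
lemma IsPotential.false_of_lower_bound (hu : IsPotential N c (fun y => ‖y‖ ^ a * u y ^ p) u)
    (hN : 0 < N) (hNd : N < finrank ℝ E) (hc : 0 < c) (ha : 0 ≤ a) (hp : 0 < p)
    (hu0 : ∀ x, 0 ≤ u x) {C ν : ℝ} (hC : 0 < C) (hν : 0 ≤ ν)
    (hνp : (p - 1) * ν < a + finrank ℝ E - N)
    (hlow : ∀ x, 1 < ‖x‖ → C * ‖x‖ ^ (-ν) ≤ u x) : False := by
  set β : ℝ := a + finrank ℝ E - N with hβ
  have hβ0 : 0 < β := by linarith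
  -- One round turns the rate `ξ` into `p ξ - β = ξ - (β - (p - 1) ξ) ≤ ξ - g` for `0 ≤ ξ ≤ ν`; the
  -- maximum with `0` covers `p < 1`.
  set g : ℝ := β - max ((p - 1) * ν) 0 with hg
  have hg0 : 0 < g := sub_pos.2 (max_lt hνp hβ0)
  have hk : ∀ k : ℕ, ∃ C > 0, ∀ x, 1 < ‖x‖ → C * ‖x‖ ^ (-(max (ν - k * g) 0)) ≤ u x := by
    intro k
    induction k with
    | zero => exact ⟨C, hC, by simpa [hν] using hlow⟩
    | succ k ih =>
      obtain ⟨C₁, hC₁, h₁⟩ := ih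
      set ξ := max (ν - k * g) 0 with hξ
      have hξ0 : 0 ≤ ξ := le_max_right _ _
      have hξν : ξ ≤ ν := max_le (by nlinarith [k.cast_nonneg (α := ℝ)]) hν
      obtain ⟨C₂, hC₂, h₂⟩ := hu.exists_improved_lower_bound hN hc ha hp hu0 hC₁ hξ0 h₁
      refine ⟨C₂, hC₂, fun x hx => le_trans ?_ (h₂ ‖x‖ hx x le_rfl)⟩
      refine mul_le_mul_of_nonneg_left (Real.rpow_le_rpow_of_exponent_le hx.le ?_) hC₂.le
      have h3 : (p - 1) * ξ ≤ max ((p - 1) * ν) 0 := by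
        rcases le_total p 1 with h | h
        · exact (mul_nonpos_of_nonpos_of_nonneg (by linarith) hξ0).trans (le_max_right _ _)
        · exact (mul_le_mul_of_nonneg_left hξν (by linarith)).trans (le_max_left _ _)
      have h4 : ξ - g ≤ max (ν - (k + 1 : ℕ) * g) 0 := by
        rw [sub_le_iff_le_add]
        refine max_le ?_ (by positivity)
        rw [← sub_le_iff_le_add]
        refine le_trans (le_of_eq ?_) (le_max_left _ _)
        push_cast
        ring
      linarith
  -- After this many rounds the rate is `0`; one more bounds `u 0` below by `C₂ R ^ β` for every `R
  -- > 1`.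
  obtain ⟨k, hkν⟩ := exists_nat_gt (ν / g)
  obtain ⟨C₁, hC₁, h₁⟩ := hk k
  rw [div_lt_iff₀ hg0] at hkν
  rw [max_eq_right (by linarith)] at h₁
  obtain ⟨C₂, hC₂, h₂⟩ := hu.exists_improved_lower_bound hN hc ha hp hu0 hC₁ le_rfl h₁
  have hlim : Tendsto (fun R : ℝ => C₂ * R ^ (a + finrank ℝ E - N - p * 0)) atTop atTop := by
    rw [mul_zero, sub_zero]
    exact (tendsto_rpow_atTop hβ0).const_mul_atTop hC₂
  obtain ⟨R, hR1, hR⟩ := ((hlim.eventually_gt_atTop (u 0)).and (eventually_gt_atTop 1)).exists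
  exact hR1.not_ge (h₂ R hR 0 (by rw [norm_zero]; linarith))

end LowerBounds

/-! ### Scaling spheres: domination at every radius, and the conclusion. -/

section ScalingSpheres

variable {E : Type*} [NormedAddCommGroup E] [InnerProductSpace ℝ E] {N c a p : ℝ} {u : E → ℝ}

/-- The radii `t` for which `u` is dominated inside the sphere of radius `t` by its Kelvin
transform with respect to that sphere. -/
def dominatedRadii (N : ℝ) (u : E → ℝ) : Set ℝ :=
  {t | ∀ y ∈ puncturedBall E, u (t • y) ≤ kelvinTransform N (fun x => u (t • x)) y}

lemma isClosed_dominatedRadii (N : ℝ) (huc : Continuous u) : IsClosed (dominatedRadii N u) := by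
  simp only [dominatedRadii, ofPred_forall, kelvinTransform]
  refine isClosed_biInter fun y _ => isClosed_le ?_ ?_ <;> fun_prop

variable [FiniteDimensional ℝ E]

lemma exists_bound_closedBall (huc : Continuous u) (R : ℝ) :
    ∃ U, 0 < U ∧ ∀ y : E, ‖y‖ ≤ R → u y ≤ U := by
  obtain ⟨U, hU⟩ := (isCompact_closedBall (0 : E) R).bddAbove_image huc.continuousOn
  exact ⟨max U 1, by positivity, fun y hy =>
    (hU (mem_image_of_mem u (mem_closedBall_zero_iff.2 hy))).trans (le_max_left _ _)⟩

variable [MeasurableSpace E] [BorelSpace E]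

/-- Rescaling replaces the sphere of radius `t` by the unit sphere, so the radius survives only in
the constant, which tends to `0` with `t` when `N < a + d`. -/
lemma IsPotential.comp_smul (hu : IsPotential N c (fun y => ‖y‖ ^ a * u y ^ p) u)
    {t : ℝ} (ht : 0 < t) :
    IsPotential N (c * t ^ (a + finrank ℝ E - N)) (fun y => ‖y‖ ^ a * u (t • y) ^ p)
      (fun x => u (t • x)) := by
  intro x
  obtain ⟨h1, h2⟩ := hu (t • x)
  have hfun : (fun y => ‖t • x - t • y‖ ^ (-N) * (‖t • y‖ ^ a * u (t • y) ^ p)) =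
      fun y => t ^ (a - N) * (‖x - y‖ ^ (-N) * (‖y‖ ^ a * u (t • y) ^ p)) := by
    funext y
    rw [← smul_sub, norm_smul, norm_smul, Real.norm_of_nonneg ht.le,
      Real.mul_rpow ht.le (norm_nonneg _), Real.mul_rpow ht.le (norm_nonneg _),
      sub_eq_add_neg a N, Real.rpow_add ht]
    ring
  have hta := Real.rpow_pos_of_pos ht (a - N)
  constructor
  · have h3 := h1.comp_smul ht.ne'
    rw [hfun] at h3
    exact (integrable_const_mul_iff (isUnit_iff_ne_zero.2 hta.ne') _).1 h3
  · have h3 := Measure.integral_comp_smul volume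
      (fun y => ‖t • x - y‖ ^ (-N) * (‖y‖ ^ a * u y ^ p)) t
    rw [hfun, integral_const_mul, smul_eq_mul, abs_of_pos (by positivity)] at h3
    have h4 : ∫ y, ‖t • x - y‖ ^ (-N) * (‖y‖ ^ a * u y ^ p) =
        t ^ finrank ℝ E * (t ^ (a - N) * ∫ y, ‖x - y‖ ^ (-N) * (‖y‖ ^ a * u (t • y) ^ p)) := by
      rw [h3]
      field_simp
    simp only
    rw [h2, h4, show a + finrank ℝ E - N = finrank ℝ E + (a - N) by ring, Real.rpow_add ht,
      Real.rpow_natCast]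
    ring

lemma exists_measure_ball_diff_closedBall_lt {δ : ENNReal} (hδ : 0 < δ) :
    ∃ r : ℝ, 0 ≤ r ∧ r < 1 ∧ volume (puncturedBall E \ closedBall 0 r) < δ := by
  have hlim := tendsto_measure_iInter_atTop (μ := volume)
    (s := fun k : ℕ => puncturedBall E \ closedBall 0 (1 - 1 / ((k : ℝ) + 1)))
    (fun k => (measurableSet_puncturedBall.diff measurableSet_closedBall).nullMeasurableSet)
    (fun i j hij => sdiff_subset_sdiff_right (closedBall_subset_closedBall
      (sub_le_sub_left (Nat.one_div_le_one_div hij) 1)))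
    ⟨0, ((measure_mono (sdiff_subset.trans sdiff_subset)).trans_lt measure_ball_lt_top).ne⟩
  have hempty : ⋂ k : ℕ, puncturedBall E \ closedBall 0 (1 - 1 / ((k : ℝ) + 1)) = ∅ := by
    refine eq_empty_of_forall_notMem fun y hy => ?_
    rw [mem_iInter] at hy
    have hy1 := (mem_puncturedBall.1 (hy 0).1).1
    obtain ⟨k, hk⟩ := exists_nat_one_div_lt (sub_pos.2 hy1)
    exact (hy k).2 (mem_closedBall_zero_iff.2 (by linarith))
  rw [hempty, measure_empty] at hlim
  obtain ⟨k, hk⟩ := (hlim.eventually (gt_mem_nhds hδ)).exists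
  have h1 := Nat.one_div_pos_of_nat (α := ℝ) (n := k)
  have h2 : 1 / ((k : ℝ) + 1) ≤ 1 := by
    rw [div_le_one (by positivity)]
    linarith [k.cast_nonneg (α := ℝ)]
  exact ⟨1 - 1 / ((k : ℝ) + 1), by linarith, by linarith, hk⟩

variable [Nontrivial E]

lemma IsPotential.exists_Ioc_subset_dominatedRadii
    (hu : IsPotential N c (fun y => ‖y‖ ^ a * u y ^ p) u)
    (hN : 0 < N) (hNd : N < finrank ℝ E) (hc : 0 < c) (ha : 0 ≤ a) (hp : 1 ≤ p)
    (hτ : 0 ≤ 2 * finrank ℝ E + 2 * a - N - N * p) (huc : Continuous u) (hu0 : ∀ x, 0 ≤ u x) :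
    ∃ T > 0, Ioc 0 T ⊆ dominatedRadii N u := by
  obtain ⟨U, hU0, hU⟩ := exists_bound_closedBall huc 1
  obtain ⟨K, hK⟩ := exists_integral_norm_sub_rpow_le (E := E) hN hNd measurableSet_puncturedBall
    ((measure_mono sdiff_subset).trans_lt measure_ball_lt_top).ne
  have hK0 : 0 ≤ K := (integral_nonneg fun y => by positivity).trans (hK 0)
  have hβ : 0 < a + finrank ℝ E - N := by linarith
  have hlim : Tendsto (fun t : ℝ => c * t ^ (a + finrank ℝ E - N) * (p * U ^ (p - 1)) * K)
      (𝓝 0) (𝓝 0) := by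
    have h := ((Real.continuousAt_rpow_const 0 (a + finrank ℝ E - N) (Or.inr hβ.le)).tendsto.const_mul
      c).mul_const (p * U ^ (p - 1)) |>.mul_const K
    rwa [Real.zero_rpow hβ.ne', mul_zero, zero_mul, zero_mul] at h
  obtain ⟨T, hT, hball⟩ := Metric.eventually_nhds_iff_ball.1
    (hlim.eventually (gt_mem_nhds (show (0 : ℝ) < 1 / 2 by norm_num)))
  refine ⟨min (T / 2) 1, by positivity, fun t ht => ?_⟩
  have ht0 : 0 < t := ht.1
  have htT : t ≤ T / 2 := ht.2.trans (min_le_left _ _)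
  have ht1 : t ≤ 1 := ht.2.trans (min_le_right _ _)
  -- Here `D` is the whole punctured ball, so no domination outside `D` has to be known.
  refine (hu.comp_smul ht0).le_kelvinTransform_of_integral_le hN hNd (by positivity) ha hp hτ
    (fun x => hu0 _) (U := U) (fun y hy => hU _ ?_) measurableSet_puncturedBall subset_rfl
    (fun y hy => absurd hy.1 hy.2) (fun x => ?_)
  · rw [norm_smul, Real.norm_of_nonneg ht0.le]
    exact mul_le_one₀ ht1 (norm_nonneg _) (mem_puncturedBall.1 hy).1.le
  · refine le_trans (mul_le_mul_of_nonneg_left (hK x) (by positivity)) (hball t ?_).le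
    rw [mem_ball_zero_iff, Real.norm_of_nonneg ht0.le]
    linarith

lemma IsPotential.eventually_mem_dominatedRadii
    (hu : IsPotential N c (fun y => ‖y‖ ^ a * u y ^ p) u)
    (hN : 0 < N) (hNd : N < finrank ℝ E) (hc : 0 < c) (ha : 0 ≤ a) (hp : 1 ≤ p)
    (hτ : 0 < 2 * finrank ℝ E + 2 * a - N - N * p) (huc : Continuous u) (hu0 : ∀ x, 0 < u x)
    {s : ℝ} (hs : 0 < s) (hsu : s ∈ dominatedRadii N u) :
    ∀ᶠ t in 𝓝[>] s, t ∈ dominatedRadii N u := by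
  have hp0 : 0 < p := by linarith
  obtain ⟨U, hU0, hU⟩ := exists_bound_closedBall huc (2 * s)
  set β : ℝ := a + finrank ℝ E - N with hβ
  have hβ0 : 0 < β := by linarith
  -- Bounds the constant for all radii `t < 2s` at once, so the shell can be chosen before `t`.
  set K : ℝ := c * (2 * s) ^ β * (p * U ^ (p - 1)) with hK
  have hK0 : 0 < K := by positivity
  obtain ⟨δ, hδ, hδint⟩ := exists_pos_integral_norm_sub_rpow_le (E := E) hN hNd
    (ε := 1 / 2 / K) (by positivity)
  obtain ⟨r, hr0, hr1, hrδ⟩ := exists_measure_ball_diff_closedBall_lt (E := E) hδ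
  obtain ⟨C, hC, hgap⟩ := (hu.comp_smul hs).exists_pos_le_kelvinTransform_sub hN
    (by positivity) ha hp0 hτ (by fun_prop) (fun x => hu0 _) hsu hr0 hr1
  -- The Kelvin transform at radius `t` and point `y` is `(s / t) ^ N` times the one at radius `s`
  -- and point `(s / t) • y`. The gap `C` there gives the expression below, which equals `C` at `t =
  -- s` and stays positive nearby by compactness.
  have hev : ∀ᶠ t in 𝓝 s, ∀ x ∈ closedBall (0 : E) 1,
      0 < (s / t) ^ N * (C + u ((s ^ 2 / t) • x)) - u (t • x) := by
    refine (isCompact_closedBall (0 : E) 1).eventually_forall_of_forall_eventually fun x _ => ?_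
    have hcont : ContinuousAt (fun q : ℝ × E =>
        (s / q.1) ^ N * (C + u ((s ^ 2 / q.1) • q.2)) - u (q.1 • q.2)) (s, x) := by
      have h1 : ContinuousAt (fun q : ℝ × E => s / q.1) (s, x) :=
        continuousAt_const.div continuousAt_fst hs.ne'
      have h2 : ContinuousAt (fun q : ℝ × E => (s ^ 2 / q.1) • q.2) (s, x) :=
        (continuousAt_const.div continuousAt_fst hs.ne').smul continuousAt_snd
      have h3 : ContinuousAt (fun q : ℝ × E => u ((s ^ 2 / q.1) • q.2)) (s, x) :=
        huc.continuousAt.comp h2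
      have h4 : ContinuousAt (fun q : ℝ × E => u (q.1 • q.2)) (s, x) := by fun_prop
      exact ((h1.rpow_const (Or.inr hN.le)).mul (continuousAt_const.add h3)).sub h4
    refine hcont.eventually (lt_mem_nhds ?_)
    have : s ^ 2 / s = s := by field_simp
    simp only [this, div_self hs.ne', Real.one_rpow, one_mul]
    linarith
  filter_upwards [mem_nhdsWithin_of_mem_nhds hev, self_mem_nhdsWithin,
    mem_nhdsWithin_of_mem_nhds (gt_mem_nhds (show s < 2 * s by linarith))] with t hΦ hst hts
  have hst' : s < t := hst
  have ht0 : 0 < t := hs.trans hst'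
  refine (hu.comp_smul ht0).le_kelvinTransform_of_integral_le hN hNd (by positivity) ha hp hτ.le
    (fun x => (hu0 _).le) (U := U) (D := puncturedBall E \ closedBall 0 r) (fun y hy => hU _ ?_)
    (measurableSet_puncturedBall.diff measurableSet_closedBall) sdiff_subset
    (fun y hy => ?_) (fun x => ?_)
  · rw [norm_smul, Real.norm_of_nonneg ht0.le]
    have := (mem_puncturedBall.1 hy).1
    nlinarith [norm_nonneg y]
  · obtain ⟨hyB, hyD⟩ := hy
    obtain ⟨hy1, hy0⟩ := mem_puncturedBall.1 hyB
    have hyr : ‖y‖ ≤ r := by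
      by_contra h
      exact hyD ⟨hyB, fun h' => h (mem_closedBall_zero_iff.1 h')⟩
    have hq : 0 < s / t := by positivity
    have hq1 : s / t ≤ 1 := (div_le_one ht0).2 hst'.le
    have hg := hgap ((s / t) • y) (smul_ne_zero hq.ne' hy0) (by
      rw [norm_smul, Real.norm_of_nonneg hq.le]
      exact (mul_le_of_le_one_left (norm_nonneg y) hq1).trans hyr)
    simp only [kelvinTransform] at hg ⊢
    rw [unitInversion_smul, smul_smul, smul_smul, norm_smul, Real.norm_of_nonneg hq.le,
      Real.mul_rpow hq.le (norm_nonneg y), show s * (s / t)⁻¹ = t by field_simp,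
      show s * (s / t) = s ^ 2 / t by ring] at hg
    have h1 := hΦ y (mem_closedBall_zero_iff.2 hy1.le)
    have h2 : (s / t) ^ N * (s / t) ^ (-N) = 1 := by
      rw [← Real.rpow_add hq, add_neg_cancel, Real.rpow_zero]
    have h3 : (s / t) ^ N * (C + u ((s ^ 2 / t) • y)) ≤
        (s / t) ^ N * ((s / t) ^ (-N) * ‖y‖ ^ (-N) * u (t • unitInversion y)) := by
      gcongr
      linarith
    rw [mul_assoc ((s / t) ^ (-N)), ← mul_assoc, h2, one_mul] at h3
    linarith
  · have h1 := hδint _ (measurableSet_puncturedBall.diff measurableSet_closedBall) hrδ x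
    have h2 : c * t ^ β * (p * U ^ (p - 1)) ≤ K := by
      rw [hK]
      gcongr
    calc _ ≤ K * (1 / 2 / K) :=
          mul_le_mul h2 h1 (integral_nonneg fun y => by positivity) hK0.le
      _ = 1 / 2 := by field_simp

/-- For subcritical exponents every radius is reached by the scaling spheres. -/
lemma IsPotential.Ioi_subset_dominatedRadii
    (hu : IsPotential N c (fun y => ‖y‖ ^ a * u y ^ p) u)
    (hN : 0 < N) (hNd : N < finrank ℝ E) (hc : 0 < c) (ha : 0 ≤ a) (hp : 1 ≤ p)
    (hτ : 0 < 2 * finrank ℝ E + 2 * a - N - N * p) (huc : Continuous u) (hu0 : ∀ x, 0 < u x) :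
    Ioi 0 ⊆ dominatedRadii N u := by
  obtain ⟨T, hT, hTs⟩ := hu.exists_Ioc_subset_dominatedRadii hN hNd hc ha hp hτ.le huc
    fun x => (hu0 x).le
  intro t ht
  have hmin : 0 < min T t := lt_min hT ht
  refine IsClosed.Icc_subset_of_forall_mem_nhdsWithin
    ((isClosed_dominatedRadii N huc).inter isClosed_Icc) (hTs ⟨hmin, min_le_left _ _⟩)
    (fun s hs => ?_) ⟨min_le_right T t, le_rfl⟩
  exact hu.eventually_mem_dominatedRadii hN hNd hc ha hp hτ huc hu0
    (hmin.trans_le hs.2.1) hs.1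

lemma IsPotential.exists_pos_lower_bound_of_subcritical
    (hu : IsPotential N c (fun y => ‖y‖ ^ a * u y ^ p) u)
    (hN : 0 < N) (hNd : N < finrank ℝ E) (hc : 0 < c) (ha : 0 ≤ a) (hp : 1 ≤ p)
    (hτ : 0 < 2 * finrank ℝ E + 2 * a - N - N * p) (huc : Continuous u) (hu0 : ∀ x, 0 < u x) :
    ∃ C > 0, ∀ x, 1 < ‖x‖ → C * ‖x‖ ^ (-(N / 2)) ≤ u x := by
  obtain ⟨z, -, hz⟩ := (isCompact_closedBall (0 : E) 1).exists_isMinOn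
    (nonempty_closedBall.2 zero_le_one) huc.continuousOn
  refine ⟨u z, hu0 z, fun x hx => ?_⟩
  have hx0 : 0 < ‖x‖ := one_pos.trans hx
  -- With this radius the mirror image of `x` has norm `t² / ‖x‖ = 1`, where `u` is at least its
  -- minimum `u z`, and the Kelvin factor is `t ^ (-N) = ‖x‖ ^ (-(N / 2))`.
  set t : ℝ := ‖x‖ ^ (1 / 2 : ℝ) with ht
  have ht0 : 0 < t := by positivity
  have htt : t * t = ‖x‖ := by
    rw [ht, ← Real.rpow_add hx0, add_halves, Real.rpow_one]
  have hnorm : ‖unitInversion (t⁻¹ • x)‖ = t⁻¹ := by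
    rw [norm_unitInversion, norm_smul, norm_inv, Real.norm_of_nonneg ht0.le, ← htt]
    field_simp
  have ht1 : 1 < t := Real.one_lt_rpow hx (by norm_num)
  have hmem := hu.Ioi_subset_dominatedRadii hN hNd hc ha hp hτ huc hu0 ht0
    (unitInversion (t⁻¹ • x)) (mem_puncturedBall.2 ⟨by rw [hnorm]; exact inv_lt_one_of_one_lt₀ ht1,
      unitInversion_ne_zero (smul_ne_zero (inv_ne_zero ht0.ne') (norm_pos_iff.1 hx0))⟩)
  simp only [kelvinTransform] at hmem
  rw [hnorm, unitInversion_unitInversion, smul_inv_smul₀ ht0.ne', Real.inv_rpow ht0.le,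
    Real.rpow_neg ht0.le, inv_inv] at hmem
  have h1 : u z ≤ u (t • unitInversion (t⁻¹ • x)) := hz (by
    rw [mem_closedBall_zero_iff, norm_smul, hnorm, Real.norm_of_nonneg ht0.le,
      mul_inv_cancel₀ ht0.ne'])
  have h2 : ‖x‖ ^ (-(N / 2)) = (t ^ N)⁻¹ := by
    rw [ht, ← Real.rpow_mul hx0.le, ← Real.rpow_neg hx0.le]
    congr 1
    ring
  rw [h2, ← div_eq_mul_inv, div_le_iff₀ (by positivity), mul_comm]
  exact h1.trans hmem

/-- Nonnegative solutions of the subcritical integral equation vanish. -/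
theorem IsPotential.eq_zero_of_subcritical (hu : IsPotential N c (fun y => ‖y‖ ^ a * u y ^ p) u)
    (hN : 0 < N) (hNd : N < finrank ℝ E) (hc : 0 < c) (ha : 0 ≤ a) (hp : 0 < p)
    (hτ : 0 < 2 * finrank ℝ E + 2 * a - N - N * p) (huc : Continuous u) (hu0 : ∀ x, 0 ≤ u x)
    (x : E) : u x = 0 := by
  by_contra hx
  obtain ⟨C, hC, ρ, hρ, hlow⟩ := hu.exists_pos_lower_bound hN hc ha hp huc hu0 hx
  rcases le_total p 1 with hp1 | hp1
  · refine hu.false_of_lower_bound hN hNd hc ha hp hu0 (C := C * (1 + ρ) ^ (-N)) (ν := N)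
      (by positivity) hN.le ?_ fun y hy => ?_
    · nlinarith
    · refine le_trans ?_ (hlow y)
      rw [mul_assoc, ← Real.mul_rpow (by positivity) (by positivity)]
      refine mul_le_mul_of_nonneg_left (Real.rpow_le_rpow_of_nonpos (by positivity) ?_
        (by linarith)) hC.le
      nlinarith
  · have hpos : ∀ y, 0 < u y := fun y => lt_of_lt_of_le (by positivity) (hlow y)
    obtain ⟨C₁, hC₁, h₁⟩ :=
      hu.exists_pos_lower_bound_of_subcritical hN hNd hc ha hp1 hτ huc hpos
    -- The rate condition `(p - 1) N / 2 < a + d - N` is `hτ` divided by two.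
    exact hu.false_of_lower_bound hN hNd hc ha hp hu0 hC₁ (by linarith) (by linarith) h₁

end ScalingSpheres

/-! ### Reduction of the Riesz integral equation to the potential equation. -/

lemma rieszConst_pos {γ : ℝ} {n : ℕ} (hγ : 0 < γ) (hγn : γ < n) : 0 < rieszConst γ n := by
  have h1 : 0 < Real.Gamma (((n : ℝ) - γ) / 2) := Real.Gamma_pos_of_pos (by linarith)
  have h2 : 0 < Real.Gamma (γ / 2) := Real.Gamma_pos_of_pos (by linarith)
  rw [rieszConst]
  positivity

lemma IsRieszIntegralSolution.isPotential {γ a p : ℝ} {n : ℕ} {u : EuclideanSpace ℝ (Fin n) → ℝ}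
    (hγ : 0 < γ) (hγn : γ < n) (hu : IsRieszIntegralSolution γ n (hardyHenon n a p) u) :
    IsPotential (n - γ) (rieszConst γ n) (fun y => ‖y‖ ^ a * u y ^ p) u := by
  intro x
  obtain ⟨h1, h2⟩ := hu x
  have hfun : (fun y => rieszKernel γ n x y * hardyHenon n a p y (u y)) =
      fun y => rieszConst γ n * (‖x - y‖ ^ (-((n : ℝ) - γ)) * (‖y‖ ^ a * u y ^ p)) := by
    funext y
    rw [rieszKernel, hardyHenon, Real.rpow_neg (norm_nonneg _)]
    ring
  rw [hfun] at h1 h2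
  rw [integral_const_mul] at h2
  exact ⟨(integrable_const_mul_iff (isUnit_iff_ne_zero.2 (rieszConst_pos hγ hγn).ne') _).1 h1, h2⟩

theorem theorem1p5 (n m : ℕ) (α a p : ℝ)
    (hm : 1 ≤ m) (hα0 : 0 < α) (hα2 : α < 2) (hn : 2 * (m : ℝ) + α < (n : ℝ))
    (ha : 0 ≤ a) (hp0 : 0 < p)
    (hp : p < ((n : ℝ) + 2 * (m : ℝ) + α + 2 * a) / ((n : ℝ) - 2 * (m : ℝ) - α))
    (u : EuclideanSpace ℝ (Fin n) → ℝ) (hu_cont : Continuous u) (hu_nonneg : ∀ x, 0 ≤ u x)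
    (hu : IsRieszIntegralSolution (2 * (m : ℝ) + α) n (hardyHenon n a p) u) :
    ∀ x, u x = 0 := by
  have hγ : 0 < 2 * (m : ℝ) + α := by positivity
  have hn0 : 0 < n := by
    have : (0 : ℝ) < n := hγ.trans hn
    exact_mod_cast this
  have : Nonempty (Fin n) := ⟨⟨0, hn0⟩⟩
  have hd : (finrank ℝ (EuclideanSpace ℝ (Fin n)) : ℝ) = n := by
    rw [finrank_euclideanSpace_fin]
  rw [lt_div_iff₀ (by linarith)] at hp
  exact (hu.isPotential hγ hn).eq_zero_of_subcritical (by linarith) (by rw [hd]; linarith)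
    (rieszConst_pos hγ hn) ha hp0 (by rw [hd]; linarith) hu_cont hu_nonneg
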